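/- Let $G$ be a finite simple graph that is unicyclic, i.e. connected with exactly one cycle. A set $S\subseteq V(G)$ is a resolving set if for any two distinct vertices $u,v$ there is an $x\in S$ with $d_G(u,x)\neq d_G(v,x)$; a metric basis is a resolving set of smallest possible cardinality; and a vertex is basis forced if it belongs to every metric basis of $G$. If $G$ has at least one basis forced vertex, then the girth of $G$ (the length of its unique cycle) is even. -/

import Mathlib

namespace SimpleGraph

variable {V : Type*}

/-- A graph is unicyclic if it is connected and contains exactly one cycle. Cycles are counted as
subgraphs, so that closed walks differing only in starting point or direction are identified. -/
def IsUnicyclic (G : SimpleGraph V) : Prop :=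
  G.Connected ∧ ∃! C : G.Subgraph, ∃ (u : V) (c : G.Walk u u), c.IsCycle ∧ c.toSubgraph = C

/-- The vertex `x` resolves the vertices `u` and `v` if its distances to them differ
(used for connected graphs). -/
def Resolves (G : SimpleGraph V) (x u v : V) : Prop :=
  G.dist u x ≠ G.dist v x

/-- Any two distinct vertices are resolved by some vertex of `S`. -/
def IsResolvingSet (G : SimpleGraph V) (S : Finset V) : Prop :=
  ∀ u v : V, u ≠ v → ∃ x ∈ S, G.Resolves x u v

/-- A metric basis is a resolving set of smallest possible cardinality. -/
def IsMetricBasis (G : SimpleGraph V) (S : Finset V) : Prop :=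
  G.IsResolvingSet S ∧ ∀ T : Finset V, G.IsResolvingSet T → S.card ≤ T.card

/-- A basis forced vertex is a vertex that belongs to every metric basis. -/
def IsBasisForced (G : SimpleGraph V) (v : V) : Prop :=
  ∀ S : Finset V, G.IsMetricBasis S → v ∈ S

end SimpleGraph

/-! Suppose the girth is odd, `v` is forced and `S` is a metric basis; then no other vertex can
replace `v` in `S`. On an odd cycle, a vertex together with either vertex opposite to it resolves
the whole cycle. Hence (`exists_isResolvingSet_insert`) one added cycle vertex repairs `S.erase v`,
unless it misses a pair of equal depth in one tree hanging off the cycle. Only `v` resolves such a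
pair, so `v` lies in that tree, off the cycle.

Exchanges then pin `v` down. It is a leaf, else it could move across a bridge
(`IsResolvingSet.insert_erase_of_isBridge`). Replacing it by its neighbor `u` can only lose pairs of
`v` and another neighbor `b` of `u`; if `s(u, b)` is a bridge, `b` itself can replace `v`
(`IsResolvingSet.insert_erase_of_leaf`). So `u` and `b` are on the cycle, whereas the missed pair
lies in one tree at positive depth. -/

namespace SimpleGraph

/-! ### Distances and bridges -/

section Bridge

variable {V : Type*} {G : SimpleGraph V} {u w x y : V}

/-- A geodesic from `x` to `y` must use the edge, hence passes through both of its ends. -/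
lemma Connected.dist_eq_of_separated_by_edge (hG : G.Connected)
    (hx : (G.deleteEdges {s(u, w)}).Reachable u x)
    (hy : ¬ (G.deleteEdges {s(u, w)}).Reachable u y) :
    G.dist x y = G.dist x u + G.dist u y ∧ G.dist x y = G.dist x w + G.dist w y := by
  classical
  obtain ⟨p, hp⟩ := hG.exists_walk_length_eq_dist x y
  have hmem : s(u, w) ∈ p.edges := by
    by_contra h
    exact hy (hx.trans (reachable_deleteEdges_iff_exists_walk.mpr ⟨p, h⟩))
  have key : ∀ z ∈ p.support, G.dist x y = G.dist x z + G.dist z y := by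
    intro z hz
    have h1 := dist_le (p.takeUntil z hz)
    have h2 := dist_le (p.dropUntil z hz)
    have h3 := congrArg Walk.length (p.take_spec hz)
    rw [Walk.length_append] at h3
    have h4 := hG.dist_triangle (u := x) (v := z) (w := y)
    omega
  exact ⟨key u (p.fst_mem_support_of_mem_edges hmem), key w (p.snd_mem_support_of_mem_edges hmem)⟩

lemma Connected.dist_bridge_of_reachable (hG : G.Connected) (hadj : G.Adj u w)
    (hb : G.IsBridge s(u, w)) (hx : (G.deleteEdges {s(u, w)}).Reachable u x) :
    G.dist x w = G.dist x u + 1 := by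
  have h := (hG.dist_eq_of_separated_by_edge hx (isBridge_iff.mp hb)).1
  rwa [dist_eq_one_iff_adj.mpr hadj] at h

lemma Connected.dist_bridge_of_not_reachable (hG : G.Connected) (hadj : G.Adj u w)
    (hy : ¬ (G.deleteEdges {s(u, w)}).Reachable u y) :
    G.dist y u = G.dist y w + 1 := by
  have h := (hG.dist_eq_of_separated_by_edge (Reachable.refl u) hy).2
  rw [dist_eq_one_iff_adj.mpr hadj, dist_comm, dist_comm (u := w)] at h
  omega

/-- Turns the sides of a bridge into linear equations between distances, the form used from here on.
-/
lemma Connected.reachable_iff_dist_bridge (hG : G.Connected) (hadj : G.Adj u w)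
    (hb : G.IsBridge s(u, w)) :
    (G.deleteEdges {s(u, w)}).Reachable u x ↔ G.dist x w = G.dist x u + 1 := by
  refine ⟨hG.dist_bridge_of_reachable hadj hb, fun h => ?_⟩
  by_contra hx
  have := hG.dist_bridge_of_not_reachable hadj hx
  omega

/-- Every vertex is strictly closer to one end of a bridge. -/
lemma Connected.dist_bridge_cases (hG : G.Connected) (hadj : G.Adj u w)
    (hb : G.IsBridge s(u, w)) (x : V) :
    G.dist x w = G.dist x u + 1 ∨ G.dist x u = G.dist x w + 1 := by
  by_cases hx : (G.deleteEdges {s(u, w)}).Reachable u x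
  · exact .inl (hG.dist_bridge_of_reachable hadj hb hx)
  · exact .inr (hG.dist_bridge_of_not_reachable hadj hx)

/-- The distance between vertices on different sides of a bridge. -/
lemma Connected.dist_across_bridge (hG : G.Connected) (hadj : G.Adj u w)
    (hb : G.IsBridge s(u, w)) (hx : G.dist x w = G.dist x u + 1)
    (hy : G.dist y u = G.dist y w + 1) :
    G.dist x y = G.dist x u + 1 + G.dist y w := by
  have hx' := (hG.reachable_iff_dist_bridge hadj hb).mpr hx
  have hy' : ¬ (G.deleteEdges {s(u, w)}).Reachable u y := by
    rw [hG.reachable_iff_dist_bridge hadj hb]; omega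
  have h := (hG.dist_eq_of_separated_by_edge hx' hy').1
  rw [dist_comm (u := u)] at h
  omega

lemma Connected.exists_adj_dist_succ (hG : G.Connected) (h : x ≠ y) :
    ∃ z, G.Adj z y ∧ G.dist x y = G.dist x z + 1 := by
  obtain ⟨p, hp⟩ := hG.exists_walk_length_eq_dist y x
  cases p with
  | nil => exact absurd rfl h
  | @cons _ z _ hyz q =>
    refine ⟨z, hyz.symm, ?_⟩
    have h1 := dist_le q
    rw [Walk.length_cons] at hp
    have h2 := hG.dist_triangle (u := y) (v := z) (w := x)
    rw [dist_eq_one_iff_adj.mpr hyz] at h2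
    rw [dist_comm (u := x), dist_comm (u := x)]
    omega

end Bridge

/-! ### Shortest cycles, and opposite vertices on odd ones -/

section Cycle

variable {V : Type*} {G : SimpleGraph V} {a b : V}

/-- Two distinct paths with the same ends produce a cycle within their union. -/
lemma exists_isCycle_length_le_of_ne {p q : G.Walk a b} (hp : p.IsPath) (hq : q.IsPath)
    (hne : p ≠ q) :
    ∃ (v : V) (c : G.Walk v v), c.IsCycle ∧ c.length ≤ p.length + q.length := by
  classical
  -- A cycle has distinct edges, so one with all edges in `E` has length at most `E.card`.
  let E : Finset (Sym2 V) := p.edges.toFinset ∪ q.edges.toFinset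
  let H : SimpleGraph V := fromEdgeSet (E : Set (Sym2 V))
  have hHE : H.edgeSet ⊆ E := by
    intro e he
    rw [edgeSet_fromEdgeSet] at he
    exact he.1
  have hE : ∀ e ∈ E, e ∈ G.edgeSet := by
    intro e he
    rcases Finset.mem_union.mp he with h | h
    · exact p.edges_subset_edgeSet (List.mem_toFinset.mp h)
    · exact q.edges_subset_edgeSet (List.mem_toFinset.mp h)
  have hH : ∀ e ∈ E, e ∈ H.edgeSet := by
    intro e he
    rw [edgeSet_fromEdgeSet]
    exact ⟨he, G.not_isDiag_of_mem_edgeSet (hE e he)⟩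
  have hpH : ∀ e ∈ p.edges, e ∈ H.edgeSet := fun e he =>
    hH e (Finset.mem_union_left _ (List.mem_toFinset.mpr he))
  have hqH : ∀ e ∈ q.edges, e ∈ H.edgeSet := fun e he =>
    hH e (Finset.mem_union_right _ (List.mem_toFinset.mpr he))
  have hac : ¬ H.IsAcyclic := by
    intro hac
    have h := (hac.subsingleton_path a b).elim ⟨_, hp.transfer hpH⟩ ⟨_, hq.transfer hqH⟩
    have h2 := congrArg Walk.support (congrArg Subtype.val h)
    simp only [Walk.support_transfer] at h2
    exact hne (Walk.ext_support h2)
  simp only [IsAcyclic, not_forall, not_not] at hac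
  obtain ⟨v, c, hc⟩ := hac
  have hcG : ∀ e ∈ c.edges, e ∈ G.edgeSet := fun e he =>
    hE e (hHE (c.edges_subset_edgeSet he))
  refine ⟨v, c.transfer G hcG, hc.transfer hcG, ?_⟩
  rw [Walk.length_transfer, ← Walk.length_edges,
    ← List.toFinset_card_of_nodup hc.edges_nodup]
  calc c.edges.toFinset.card ≤ E.card :=
        Finset.card_le_card fun e he => hHE (c.edges_subset_edgeSet (List.mem_toFinset.mp he))
    _ ≤ _ := Finset.card_union_le _ _
    _ ≤ p.edges.length + q.edges.length :=
        Nat.add_le_add (List.toFinset_card_le _) (List.toFinset_card_le _)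
    _ = _ := by rw [Walk.length_edges, Walk.length_edges]

/-- The arc of a cycle between two of its vertices. -/
lemma Walk.IsCycle.exists_isPath_getVert {c : G.Walk a a} (hc : c.IsCycle) {i j : ℕ}
    (hij : i ≤ j) (hj : j < c.length) :
    ∃ p : G.Walk (c.getVert i) (c.getVert j), p.IsPath ∧ p.length = j - i := by
  have h : (c.take j).getVert i = c.getVert i := by
    rw [Walk.take_getVert, min_eq_right hij]
  refine ⟨((c.take j).drop i).copy h rfl, ?_, ?_⟩
  · simpa using (hc.isPath_take hj).drop i
  · simp [hj.le]

/-- A cycle whose length is the girth is isometrically embedded. -/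
lemma Walk.IsCycle.dist_getVert {c : G.Walk a a} (hc : c.IsCycle) (hG : G.Connected)
    (hlen : c.length = G.girth) {i j : ℕ} (hij : i ≤ j) (hj : j < c.length) :
    G.dist (c.getVert i) (c.getVert j) = min (j - i) (c.length - (j - i)) := by
  obtain ⟨p, hp, hpl⟩ := hc.exists_isPath_getVert hij hj
  have h1 : G.dist (c.getVert i) (c.getVert j) ≤ j - i := hpl ▸ dist_le p
  have h2 : G.dist (c.getVert i) a ≤ i := by
    rw [dist_comm]
    have := dist_le (c.take i)
    rw [Walk.take_length] at this
    omega
  have h3 : G.dist (c.getVert j) a ≤ c.length - j := by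
    have := dist_le (c.drop j)
    rwa [Walk.drop_length] at this
  have h4 := hG.dist_triangle (u := c.getVert i) (v := a) (w := c.getVert j)
  rw [dist_comm (u := a)] at h4
  by_contra hne
  -- A geodesic shorter than both arcs would form, with the arc `p`, a cycle shorter than the girth.
  obtain ⟨q, hq, hql⟩ := hG.exists_path_of_dist (c.getVert i) (c.getVert j)
  have hpq : p ≠ q := by
    rintro rfl
    omega
  obtain ⟨v, c', hc', hle⟩ := exists_isCycle_length_le_of_ne hp hq hpq
  have := girth_le_length hc'
  omega

/-- For the vertex at position `t`, this computes its distance to position 0 minus its distance to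
the opposite position `k`. The difference is congruent to `k` mod 2 in the first case and to `k + 1`
in the others, because the length is odd. Hence it determines `t`. -/
lemma cyclic_dist_sub_opposite {m k t : ℕ} (hk : k = m ∨ k = m + 1) (ht : t < 2 * m + 1) :
    ((t ≤ m ∧ (k = m ∨ t ≠ 0) ∧
        min t (2 * m + 1 - t) + k =
          min ((t - k) + (k - t)) (2 * m + 1 - ((t - k) + (k - t))) + 2 * t) ∨
      (m < t ∧ min t (2 * m + 1 - t) + 2 * t =
        min ((t - k) + (k - t)) (2 * m + 1 - ((t - k) + (k - t))) + (2 * m + 1 + k)) ∨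
      (t = 0 ∧ k = m + 1 ∧ min t (2 * m + 1 - t) + m =
        min ((t - k) + (k - t)) (2 * m + 1 - ((t - k) + (k - t))))) := by
  rcases le_or_gt t m with h | h
  · rcases hk with rfl | rfl
    · left; omega
    · rcases Nat.eq_zero_or_pos t with rfl | h0
      · right; right; omega
      · left; omega
  · right; left; rcases hk with rfl | rfl <;> omega

/-- In a graph of odd girth, a vertex `p` of a shortest cycle together with either of the two
vertices opposite to it resolves all pairs of vertices of the cycle. -/
lemma Walk.IsCycle.exists_antipodal_of_odd {c : G.Walk a a} (hc : c.IsCycle) (hG : G.Connected)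
    (hlen : c.length = G.girth) (hodd : Odd G.girth) {p : V} (hp : p ∈ c.support) (v : V) :
    ∃ q ∈ c.support, q ≠ v ∧ q ≠ p ∧ (∀ i ∈ c.support, G.dist i q ≤ G.dist p q) ∧
      ∀ i ∈ c.support, ∀ j ∈ c.support,
        G.dist i p + G.dist j q = G.dist j p + G.dist i q → i = j := by
  classical
  obtain ⟨m, hm⟩ := hodd
  set c' := c.rotate p hp with hc'
  have hcyc : c'.IsCycle := (Walk.isCycle_rotate hp).mpr hc
  have hsupp : ∀ z, z ∈ c'.support ↔ z ∈ c.support := fun z => Walk.mem_support_rotate_iff c p hp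
  have hl' : c'.length = G.girth := by rw [hc', Walk.length_rotate, hlen]
  have hm' : c'.length = 2 * m + 1 := hl'.trans hm
  have h3 := hcyc.three_le_length
  have hd : ∀ i j, i ≤ j → j < c'.length →
      G.dist (c'.getVert i) (c'.getVert j) = min (j - i) (c'.length - (j - i)) :=
    fun i j h1 h2 => hcyc.dist_getVert hG hl' h1 h2
  have hd' : ∀ i j, i < c'.length → j < c'.length →
      G.dist (c'.getVert i) (c'.getVert j) =
        min ((i - j) + (j - i)) (c'.length - ((i - j) + (j - i))) := by
    intro i j hi hj
    rcases le_total i j with h | h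
    · rw [hd i j h hj, Nat.sub_eq_zero_of_le h, zero_add]
    · rw [dist_comm, hd j i h hi, Nat.sub_eq_zero_of_le h, add_zero]
  have hcoord : ∀ i ∈ c.support, ∃ t < c'.length, c'.getVert t = i := by
    intro i hi
    obtain ⟨t, ht, htl⟩ := Walk.mem_support_iff_exists_getVert.mp ((hsupp i).mpr hi)
    rcases htl.lt_or_eq with h | h
    · exact ⟨t, h, ht⟩
    · refine ⟨0, by omega, ?_⟩
      rw [Walk.getVert_zero, ← ht, h, Walk.getVert_length]
  -- Both opposite positions work, so one of them avoids `v`.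
  have main : ∀ k, k = m ∨ k = m + 1 → c'.getVert k ∈ c.support ∧ c'.getVert k ≠ p ∧
      (∀ i ∈ c.support, G.dist i (c'.getVert k) ≤ G.dist p (c'.getVert k)) ∧
      ∀ i ∈ c.support, ∀ j ∈ c.support,
        G.dist i p + G.dist j (c'.getVert k) = G.dist j p + G.dist i (c'.getVert k) → i = j := by
    intro k hk
    have hkl : k < c'.length := by omega
    have hpk := hd' 0 k (by omega) hkl
    rw [Walk.getVert_zero] at hpk
    refine ⟨(hsupp _).mp (Walk.getVert_mem_support _ _), ?_, ?_, ?_⟩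
    · intro h
      rw [h, dist_self] at hpk
      omega
    · intro i hi
      obtain ⟨t, ht, rfl⟩ := hcoord i hi
      rw [hpk, hd' t k ht hkl]
      omega
    · intro i hi j hj hij
      obtain ⟨t, ht, rfl⟩ := hcoord i hi
      obtain ⟨t', ht', rfl⟩ := hcoord j hj
      have e1 := hd' t 0 ht (by omega)
      have e2 := hd' t' 0 ht' (by omega)
      rw [Walk.getVert_zero] at e1 e2
      rw [e1, e2, hd' t k ht hkl, hd' t' k ht' hkl] at hij
      congr 1
      have ht1 := cyclic_dist_sub_opposite hk (hm' ▸ ht)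
      have ht2 := cyclic_dist_sub_opposite hk (hm' ▸ ht')
      simp only [Nat.sub_zero, Nat.zero_sub, add_zero, hm'] at hij ht ht'
      generalize min t (2 * m + 1 - t) = A at *
      generalize min t' (2 * m + 1 - t') = A' at *
      generalize min ((t - k) + (k - t)) (2 * m + 1 - ((t - k) + (k - t))) = B at *
      generalize min ((t' - k) + (k - t')) (2 * m + 1 - ((t' - k) + (k - t'))) = B' at *
      rcases ht1 with h | h | h <;> rcases ht2 with h' | h' | h' <;> omega
  by_cases hv : c'.getVert m = v
  · obtain ⟨h1, h2, h3, h4⟩ := main (m + 1) (.inr rfl)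
    refine ⟨_, h1, ?_, h2, h3, h4⟩
    rw [← hv]
    intro h
    have := hd' m (m + 1) (by omega) (by omega)
    rw [h, dist_self] at this
    omega
  · obtain ⟨h1, h2, h3, h4⟩ := main m (.inl rfl)
    exact ⟨_, h1, hv, h2, h3, h4⟩

/-- A vertex of a shortest cycle has two distinct neighbors on the cycle. -/
lemma Walk.IsCycle.exists_two_adj {c : G.Walk a a} (hc : c.IsCycle) {p : V}
    (hp : p ∈ c.support) :
    ∃ y ∈ c.support, ∃ z ∈ c.support, y ≠ z ∧ G.Adj p y ∧ G.Adj p z := by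
  classical
  have hcyc : (c.rotate p hp).IsCycle := (Walk.isCycle_rotate hp).mpr hc
  refine ⟨(c.rotate p hp).snd, ?_, (c.rotate p hp).penultimate, ?_, hcyc.snd_ne_penultimate,
    Walk.adj_snd hcyc.not_nil, (Walk.adj_penultimate hcyc.not_nil).symm⟩
  · exact (Walk.mem_support_rotate_iff c p hp).mp (Walk.getVert_mem_support _ _)
  · exact (Walk.mem_support_rotate_iff c p hp).mp (Walk.getVert_mem_support _ _)

end Cycle

/-! ### Gates of the trees hanging off the cycle -/

section Gate

variable {V : Type*} {G : SimpleGraph V} {a u w x y : V} {c : G.Walk a a}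

/-- In a unicyclic graph all edges outside the cycle are bridges. -/
lemma IsUnicyclic.isBridge_of_notMem_edges (hG : G.IsUnicyclic) (hc : c.IsCycle)
    (hadj : G.Adj u w) (he : s(u, w) ∉ c.edges) : G.IsBridge s(u, w) := by
  rw [isBridge_iff_forall_cycle_notMem (G.mem_edgeSet.mpr hadj)]
  intro v p hp hmem
  have h : p.toSubgraph = c.toSubgraph := hG.2.unique ⟨v, p, hp, rfl⟩ ⟨a, c, hc, rfl⟩
  rw [← Walk.mem_edges_toSubgraph, h, Walk.mem_edges_toSubgraph] at hmem
  exact he hmem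

/-- A closed walk lies on one side of every bridge that it does not use. -/
lemma Walk.dist_bridge_of_mem_support (c : G.Walk a a) (hG : G.Connected) (hadj : G.Adj u w)
    (hb : G.IsBridge s(u, w)) (he : s(u, w) ∉ c.edges) (hx : x ∈ c.support)
    (hy : y ∈ c.support) (h : G.dist x w = G.dist x u + 1) : G.dist y w = G.dist y u + 1 := by
  classical
  rw [← hG.reachable_iff_dist_bridge hadj hb] at h ⊢
  have key : ∀ z ∈ c.support, (G.deleteEdges {s(u, w)}).Reachable a z := fun z hz =>
    reachable_deleteEdges_iff_exists_walk.mpr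
      ⟨c.takeUntil z hz, fun h => he (c.edges_takeUntil_subset_edges hz h)⟩
  exact (h.trans (key x hx).symm).trans (key y hy)

/-- A vertex off a closed walk is cut off from the walk by a bridge at its nearest vertex. -/
lemma Walk.exists_nearest (c : G.Walk a a) (hG : G.Connected)
    (x : V) :
    ∃ r ∈ c.support, x = r ∨
      ∃ p, G.Adj p r ∧ s(p, r) ∉ c.edges ∧ G.dist x r = G.dist x p + 1 := by
  classical
  obtain ⟨r, hr, hmin⟩ := c.support.toFinset.exists_min_image (G.dist x)
    ⟨a, List.mem_toFinset.mpr c.start_mem_support⟩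
  rw [List.mem_toFinset] at hr
  refine ⟨r, hr, or_iff_not_imp_left.mpr fun hne => ?_⟩
  obtain ⟨p, hp, hd⟩ := hG.exists_adj_dist_succ hne
  refine ⟨p, hp, fun he => ?_, hd⟩
  have := hmin p (List.mem_toFinset.mpr (c.fst_mem_support_of_mem_edges he))
  omega

/-- If all edges outside a closed walk are bridges, then each vertex `x` has a gate `r x` on
the walk: the trees hanging off the walk are attached at their gates. -/
lemma Walk.exists_gate (c : G.Walk a a) (hG : G.Connected)
    (hbr : ∀ ⦃u w⦄, G.Adj u w → s(u, w) ∉ c.edges → G.IsBridge s(u, w)) :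
    ∃ r : V → V, (∀ x, r x ∈ c.support) ∧
      (∀ x, ∀ z ∈ c.support, G.dist x z = G.dist x (r x) + G.dist (r x) z) ∧
      ∀ x y, r x ≠ r y → G.dist x y = G.dist x (r x) + G.dist (r x) y := by
  choose r hr hx using c.exists_nearest hG
  have side : ∀ p r, G.Adj p r → s(p, r) ∉ c.edges → r ∈ c.support → ∀ z ∈ c.support,
      G.dist z p = G.dist z r + 1 := by
    intro p r hadj he hr z hz
    rw [Sym2.eq_swap] at he
    refine c.dist_bridge_of_mem_support hG hadj.symm (hbr hadj.symm he) he hr hz ?_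
    rw [dist_self, dist_eq_one_iff_adj.mpr hadj.symm]
  have gate : ∀ x, ∀ z ∈ c.support, G.dist x z = G.dist x (r x) + G.dist (r x) z := by
    intro x z hz
    rcases hx x with h | ⟨p, hadj, he, hd⟩
    · rw [← h, dist_self, zero_add]
    · rw [hG.dist_across_bridge hadj (hbr hadj he) hd (side p _ hadj he (hr x) z hz), hd,
        dist_comm (u := z)]
  refine ⟨r, hr, gate, fun x y hne => ?_⟩
  rcases hx x with h | ⟨p, hadj, he, hd⟩
  · rw [← h, dist_self, zero_add]
  rcases hG.dist_bridge_cases hadj (hbr hadj he) y with hy | hy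
  · have h1 := hG.dist_across_bridge hadj (hbr hadj he) hy
      (side p _ hadj he (hr x) (r y) (hr y))
    have h2 := gate y (r x) (hr x)
    have h3 : G.dist (r y) (r x) = 0 := by omega
    exact absurd (hG.dist_eq_zero_iff.mp h3).symm hne
  · rw [hG.dist_across_bridge hadj (hbr hadj he) hd hy, hd, dist_comm (u := y)]

end Gate

/-! ### Exchanging one element of a resolving set -/

section Resolving

variable {V : Type*} [DecidableEq V] {G : SimpleGraph V} {S : Finset V} {u v w x y : V}

lemma IsResolvingSet.insert_erase_of_forall_resolves (hS : G.IsResolvingSet S)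
    (h : ∀ x y, G.Resolves v x y → ∃ s ∈ insert w (S.erase v), G.Resolves s x y) :
    G.IsResolvingSet (insert w (S.erase v)) := by
  intro x y hxy
  obtain ⟨s, hs, hr⟩ := hS x y hxy
  by_cases hsv : s = v
  · exact h x y (hsv ▸ hr)
  · exact ⟨s, Finset.mem_insert_of_mem (Finset.mem_erase.mpr ⟨hsv, hs⟩), hr⟩

/-- Moving an element of a resolving set over a bridge, away from another element. -/
lemma IsResolvingSet.insert_erase_of_isBridge (hS : G.IsResolvingSet S) (hG : G.Connected)
    (hadj : G.Adj v w) (hb : G.IsBridge s(v, w))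
    (hs : ∃ s ∈ S.erase v, G.dist s w = G.dist s v + 1) :
    G.IsResolvingSet (insert w (S.erase v)) := by
  obtain ⟨s, hsS, hs⟩ := hs
  have key : ∀ x y, G.dist x w = G.dist x v + 1 → G.dist y v = G.dist y w + 1 →
      G.dist x v ≠ G.dist y v → ∃ s ∈ insert w (S.erase v), G.Resolves s x y := by
    intro x y hx hy hne
    -- If `w` fails, then `y` is farther from `s` than `x` is: the path from `s` to `y` crosses the
    -- bridge.
    by_cases h : G.dist x w = G.dist y w
    · refine ⟨s, Finset.mem_insert_of_mem hsS, ?_⟩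
      have h1 := hG.dist_across_bridge hadj hb hs hy
      have h2 := hG.dist_triangle (u := x) (v := v) (w := s)
      rw [dist_comm (u := v)] at h2
      rw [dist_comm (u := s)] at h1
      unfold Resolves
      omega
    · exact ⟨w, Finset.mem_insert_self _ _, h⟩
  refine hS.insert_erase_of_forall_resolves fun x y hxy => ?_
  rcases hG.dist_bridge_cases hadj hb x with hx | hx <;>
    rcases hG.dist_bridge_cases hadj hb y with hy | hy
  · refine ⟨w, Finset.mem_insert_self _ _, ?_⟩
    unfold Resolves at *
    omega
  · exact key x y hx hy hxy
  · obtain ⟨t, ht, h⟩ := key y x hy hx (Ne.symm hxy)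
    exact ⟨t, ht, Ne.symm h⟩
  · refine ⟨w, Finset.mem_insert_self _ _, ?_⟩
    unfold Resolves at *
    omega

/-- Replacing a leaf `v` at `u` by another neighbor `w` of `u`, if the branch of `w` at `u`
contains no further element of the resolving set. -/
lemma IsResolvingSet.insert_erase_of_leaf (hS : G.IsResolvingSet S) (hG : G.Connected)
    (hleaf : ∀ x, x ≠ v → G.dist x v = G.dist x u + 1)
    (hadj : G.Adj u w) (hb : G.IsBridge s(u, w)) (hwv : w ≠ v) (hne : (S.erase v).Nonempty)
    (hfree : ∀ s ∈ S.erase v, G.dist s w = G.dist s u + 1) :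
    G.IsResolvingSet (insert w (S.erase v)) := by
  obtain ⟨s, hsS⟩ := hne
  have hs := hfree s hsS
  have hsv := (Finset.mem_erase.mp hsS).1
  have hvu : v ≠ u := by
    rintro rfl
    have h1 := hleaf w hwv
    omega
  have huv : G.dist u v = 1 := by rw [hleaf u hvu.symm, dist_self]
  have hvw : G.dist v w = 2 := by
    rw [dist_comm, hleaf w hwv, dist_comm, dist_eq_one_iff_adj.mpr hadj]
  have key : ∀ x y, G.dist x u = G.dist x w + 1 → G.dist y w = G.dist y u + 1 →
      G.Resolves v x y → ∃ s ∈ insert w (S.erase v), G.Resolves s x y := by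
    intro x y hx hy hxy
    by_cases h : G.dist x w = G.dist y w
    · have h1 := hG.dist_across_bridge hadj hb hs hx
      have h2 := hG.dist_triangle (u := y) (v := u) (w := s)
      rw [dist_comm (u := u)] at h2
      rw [dist_comm (u := s)] at h1
      exact ⟨s, Finset.mem_insert_of_mem hsS, by unfold Resolves; omega⟩
    · exact ⟨w, Finset.mem_insert_self _ _, h⟩
  have hvside : G.dist v w = G.dist v u + 1 := by rw [hvw, dist_comm, huv]
  have keyv : ∀ y, y ≠ v → ∃ s ∈ insert w (S.erase v), G.Resolves s v y := by
    intro y hyv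
    rcases hG.dist_bridge_cases hadj hb y with hy | hy
    · by_cases h1 : G.dist y u = 1
      · obtain ⟨t, htS, ht⟩ := hS w y (by rintro rfl; rw [dist_self] at hy; omega)
        by_cases htv : t = v
        · subst htv
          exact absurd (by rw [hleaf _ hwv, hleaf _ hyv, h1, dist_comm,
            dist_eq_one_iff_adj.mpr hadj]) ht
        · have htS' := Finset.mem_erase.mpr ⟨htv, htS⟩
          refine ⟨t, Finset.mem_insert_of_mem htS', ?_⟩
          have e1 := hfree t htS'
          have e2 := hleaf t htv
          rw [dist_comm] at e1 e2
          unfold Resolves at *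
          omega
      · exact ⟨w, Finset.mem_insert_self _ _, by unfold Resolves; omega⟩
    · obtain ⟨t, ht, h⟩ := key y v hy hvside (by
        unfold Resolves
        rw [hleaf y hyv, dist_self]
        omega)
      exact ⟨t, ht, h.symm⟩
  refine hS.insert_erase_of_forall_resolves fun x y hxy => ?_
  have hxy' : x ≠ y := by rintro rfl; exact hxy rfl
  by_cases hxv : x = v
  · subst hxv
    exact keyv y hxy'.symm
  by_cases hyv : y = v
  · subst hyv
    obtain ⟨t, ht, h⟩ := keyv x hxy'
    exact ⟨t, ht, h.symm⟩
  rcases hG.dist_bridge_cases hadj hb x with hx | hx <;>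
    rcases hG.dist_bridge_cases hadj hb y with hy | hy
  · refine ⟨w, Finset.mem_insert_self _ _, ?_⟩
    unfold Resolves at *
    rw [hleaf x hxv, hleaf y hyv] at hxy
    omega
  · obtain ⟨t, ht, h⟩ := key y x hy hx hxy.symm
    exact ⟨t, ht, h.symm⟩
  · exact key x y hx hy hxy
  · refine ⟨w, Finset.mem_insert_self _ _, ?_⟩
    unfold Resolves at *
    rw [hleaf x hxv, hleaf y hyv] at hxy
    omega

/-- Replacing a leaf `v` by its neighbor `u` only affects pairs formed by `v` and another
neighbor of `u`. -/
lemma IsResolvingSet.exists_resolves_or_of_leaf (hS : G.IsResolvingSet S)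
    (hleaf : ∀ x, x ≠ v → G.dist x v = G.dist x u + 1) (hvu : v ≠ u) (hxy : x ≠ y) :
    (∃ s ∈ insert u (S.erase v), G.Resolves s x y) ∨
      (x = v ∧ G.Adj u y) ∨ (y = v ∧ G.Adj u x) := by
  have hvu1 : G.dist v u = 1 := by rw [dist_comm, hleaf u hvu.symm, dist_self]
  by_cases hu : G.dist x u = G.dist y u
  · by_cases hxv : x = v
    · subst hxv
      refine .inr (.inl ⟨rfl, (dist_eq_one_iff_adj.mp ?_).symm⟩)
      rw [← hu, hvu1]
    by_cases hyv : y = v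
    · subst hyv
      refine .inr (.inr ⟨rfl, (dist_eq_one_iff_adj.mp ?_).symm⟩)
      rw [hu, hvu1]
    · obtain ⟨s, hsS, hs⟩ := hS x y hxy
      refine .inl ⟨s, Finset.mem_insert_of_mem (Finset.mem_erase.mpr ⟨?_, hsS⟩), hs⟩
      rintro rfl
      exact hs (by rw [hleaf x hxv, hleaf y hyv, hu])
  · exact .inl ⟨u, Finset.mem_insert_self _ _, hu⟩

end Resolving

/-! ### Forced vertices and the repair by a cycle vertex -/

section Forced

variable {V : Type*} {G : SimpleGraph V} {S : Finset V} {a v w : V}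

lemma exists_isMetricBasis [Finite V] (G : SimpleGraph V) (hG : G.Connected) :
    ∃ S : Finset V, G.IsMetricBasis S := by
  classical
  have := Fintype.ofFinite V
  have huniv : G.IsResolvingSet Finset.univ := by
    refine fun u v huv => ⟨u, Finset.mem_univ u, fun h => huv (hG.dist_eq_zero_iff.mp ?_)⟩
    rw [dist_comm, ← h, dist_self]
  obtain ⟨S, hS, hmin⟩ := (Finset.univ.filter G.IsResolvingSet).exists_min_image Finset.card
    ⟨_, Finset.mem_filter.mpr ⟨Finset.mem_univ _, huniv⟩⟩
  exact ⟨S, (Finset.mem_filter.mp hS).2,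
    fun T hT => hmin T (Finset.mem_filter.mpr ⟨Finset.mem_univ _, hT⟩)⟩

/-- A basis forced vertex cannot be exchanged for another vertex. -/
lemma IsBasisForced.not_isResolvingSet_insert_erase [DecidableEq V] (hv : G.IsBasisForced v)
    (hS : G.IsMetricBasis S) (hw : w ≠ v) : ¬ G.IsResolvingSet (insert w (S.erase v)) := by
  intro h
  have hvS := hv S hS
  have hcard : (insert w (S.erase v)).card ≤ S.card :=
    (Finset.card_insert_le _ _).trans_eq (Finset.card_erase_add_one hvS)
  have hmem := hv _ ⟨h, fun T hT => hcard.trans (hS.2 T hT)⟩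
  rcases Finset.mem_insert.mp hmem with h | h
  · exact hw h.symm
  · exact Finset.notMem_erase v S h

variable {c : G.Walk a a} {r : V → V}

/-- The two cycle neighbors of `p` are equidistant from every vertex with gate `p`. -/
lemma IsResolvingSet.exists_gate_ne (hS : G.IsResolvingSet S) (hc : c.IsCycle)
    (hgate : ∀ x, ∀ z ∈ c.support, G.dist x z = G.dist x (r x) + G.dist (r x) z) {p : V}
    (hp : p ∈ c.support) : ∃ s ∈ S, r s ≠ p := by
  obtain ⟨y, hy, z, hz, hyz, hpy, hpz⟩ := hc.exists_two_adj hp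
  obtain ⟨s, hsS, hs⟩ := hS y z hyz
  refine ⟨s, hsS, ?_⟩
  rintro rfl
  refine hs ?_
  rw [dist_comm, hgate s y hy, dist_comm (u := z), hgate s z hz, dist_eq_one_iff_adj.mpr hpy,
    dist_eq_one_iff_adj.mpr hpz]

/-- In a connected graph with an odd shortest cycle whose remaining edges are bridges, a nonempty
set that resolves the pairs at equal depth in the same tree hanging off the cycle becomes resolving
by adding a suitable cycle vertex. -/
lemma exists_isResolvingSet_insert [DecidableEq V] (hG : G.Connected) (hc : c.IsCycle)
    (hlen : c.length = G.girth) (hodd : Odd G.girth) (hr : ∀ x, r x ∈ c.support)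
    (hgate : ∀ x, ∀ z ∈ c.support, G.dist x z = G.dist x (r x) + G.dist (r x) z)
    (hgate' : ∀ x y, r x ≠ r y → G.dist x y = G.dist x (r x) + G.dist (r x) y)
    (hS : S.Nonempty)
    (hE : ∀ x y, x ≠ y → r x = r y → G.dist x (r x) = G.dist y (r y) → ∃ s ∈ S, G.Resolves s x y)
    (v : V) : ∃ q, q ≠ v ∧ G.IsResolvingSet (insert q S) := by
  obtain ⟨s, hs⟩ := hS
  obtain ⟨q, hq, hqv, hqp, hmax, hinj⟩ := hc.exists_antipodal_of_odd hG hlen hodd (hr s) v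
  have hrq : r q = q := by
    have := hgate q q hq
    rw [dist_self] at this
    exact (hG.dist_eq_zero_iff.mp (by omega : G.dist q (r q) = 0)).symm
  refine ⟨q, hqv, fun x y hxy => ?_⟩
  by_cases hrxy : r x = r y
  · by_cases hd : G.dist x (r x) = G.dist y (r y)
    · obtain ⟨t, ht, h⟩ := hE x y hxy hrxy hd
      exact ⟨t, Finset.mem_insert_of_mem ht, h⟩
    · have hout : ∀ t, r x ≠ r t → G.Resolves t x y := by
        intro t ht
        unfold Resolves
        rw [hgate' x t ht, hgate' y t (hrxy ▸ ht), ← hrxy]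
        rw [← hrxy] at hd
        omega
      by_cases hxs : r x = r s
      · exact ⟨q, Finset.mem_insert_self _ _, hout q (by rw [hxs, hrq]; exact hqp.symm)⟩
      · exact ⟨s, Finset.mem_insert_of_mem hs, hout s hxs⟩
  · by_contra hcon
    push Not at hcon
    have e1 := not_not.mp (hcon q (Finset.mem_insert_self _ _))
    have e2 := not_not.mp (hcon s (Finset.mem_insert_of_mem hs))
    rw [hgate x q hq, hgate y q hq] at e1
    have key : ∀ z, r z ≠ r s →
        G.dist z s = G.dist z (r z) + G.dist (r z) (r s) + G.dist s (r s) := by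
      intro z hz
      rw [hgate' z s hz, dist_comm (u := r z), hgate s (r z) (hr z), dist_comm (u := r s)]
      omega
    have upper : ∀ z, r z = r s → G.dist z s ≤ G.dist z (r z) + G.dist s (r s) := by
      intro z hz
      have := hG.dist_triangle (u := z) (v := r z) (w := s)
      rw [dist_comm (u := r z), hz] at this
      rwa [hz]
    -- Equal distances to `s` make `z` strictly deeper than `z'`, but equal distances to `q` make it
    -- at most as deep, since `r s` is farthest from `q` on the cycle.
    have half : ∀ z z', r z = r s → r z' ≠ r s →
        G.dist z (r z) + G.dist (r z) q = G.dist z' (r z') + G.dist (r z') q →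
        G.dist z s = G.dist z' s → False := by
      intro z z' hz hz' h1 h2
      have h3 := upper z hz
      have h4 := key z' hz'
      have h5 := hmax (r z') (hr z')
      have h6 : G.dist (r z') (r s) ≠ 0 := fun h => hz' (hG.dist_eq_zero_iff.mp h)
      rw [hz] at h1 h3
      omega
    by_cases hx : r x = r s
    · exact half x y hx (fun h => hrxy (hx.trans h.symm)) e1 e2
    by_cases hy : r y = r s
    · exact half y x hy hx e1.symm e2.symm
    · rw [key x hx, key y hy] at e2
      exact hrxy (hinj _ (hr x) _ (hr y) (by omega))

end Forced

end SimpleGraph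

/-! ### The main argument -/

open SimpleGraph in
theorem mainTheorem3 {V : Type*} [Finite V] (G : SimpleGraph V) (hG : G.IsUnicyclic)
    (hforced : ∃ v : V, G.IsBasisForced v) : Even G.girth := by
  classical
  by_contra hodd
  rw [Nat.not_even_iff_odd] at hodd
  obtain ⟨v, hv⟩ := hforced
  have hconn := hG.1
  have hcyc : ¬ G.IsAcyclic := by
    obtain ⟨_, ⟨u, c, hc, -⟩, -⟩ := hG.2
    exact fun h => h c hc
  obtain ⟨a, c, hc, hlen⟩ := exists_girth_eq_length.mpr hcyc
  have hbr : ∀ ⦃u w⦄, G.Adj u w → s(u, w) ∉ c.edges → G.IsBridge s(u, w) :=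
    fun u w h1 h2 => hG.isBridge_of_notMem_edges hc h1 h2
  obtain ⟨r, hr, hgate, hgate'⟩ := c.exists_gate hconn hbr
  obtain ⟨S, hS⟩ := G.exists_isMetricBasis hconn
  have hvS := hv S hS
  have hno : ∀ w, w ≠ v → ¬ G.IsResolvingSet (insert w (S.erase v)) :=
    fun w hw => hv.not_isResolvingSet_insert_erase hS hw
  obtain ⟨s, hsS, hsv⟩ := hS.1.exists_gate_ne hc hgate (hr v)
  have hs : s ∈ S.erase v := Finset.mem_erase.mpr ⟨fun h => hsv (h ▸ rfl), hsS⟩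
  have hrc : ∀ z ∈ c.support, r z = z := by
    intro z hz
    have := hgate z z hz
    rw [dist_self] at this
    exact (hconn.dist_eq_zero_iff.mp (by omega : G.dist z (r z) = 0)).symm
  have hE : ∃ x y, x ≠ y ∧ r x = r y ∧ G.dist x (r x) = G.dist y (r y) ∧
      ∀ s ∈ S.erase v, ¬ G.Resolves s x y := by
    by_contra! h
    obtain ⟨q, hqv, hq⟩ := exists_isResolvingSet_insert hconn hc hlen.symm hodd hr hgate hgate'
      ⟨s, hs⟩ h v
    exact hno q hqv hq
  obtain ⟨x, y, hxy, hrxy, hdxy, hres⟩ := hE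
  have hresv : G.Resolves v x y := by
    obtain ⟨t, htS, ht⟩ := hS.1 x y hxy
    by_cases htv : t = v
    · exact htv ▸ ht
    · exact absurd ht (hres t (Finset.mem_erase.mpr ⟨htv, htS⟩))
  have hrx : r x = r v := by
    by_contra h
    refine hresv ?_
    rw [hgate' x v h, hgate' y v (hrxy ▸ h), hdxy, hrxy]
  by_cases hvc : v ∈ c.support
  · have hrv := hrc v hvc
    rw [← hrxy, hrx, hrv] at hdxy
    exact hresv hdxy
  · have hbv : ∀ w, G.Adj v w → G.IsBridge s(v, w) := fun w hw =>
      hbr hw fun h => hvc (c.fst_mem_support_of_mem_edges h)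
    have hside : ∀ w, G.Adj v w → ∀ t ∈ S.erase v, G.dist t v = G.dist t w + 1 := by
      intro w hw t ht
      refine (hconn.dist_bridge_cases hw (hbv w hw) t).resolve_left fun h => ?_
      exact hno w hw.ne' (hS.1.insert_erase_of_isBridge hconn hw (hbv w hw) ⟨t, ht, h⟩)
    -- A second neighbor would put `s` beyond two different bridges at `v`.
    have huniq : ∀ w w', G.Adj v w → G.Adj v w' → w = w' := by
      intro w w' hw hw'
      by_contra hne
      have h1 := hside w hw s hs
      have h2 := hside w' hw' s hs
      rcases hconn.dist_bridge_cases hw (hbv w hw) w' with h | h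
      · have := hconn.dist_across_bridge hw (hbv w hw) h h1
        rw [dist_comm (u := w'), dist_comm (u := w')] at this
        omega
      · rw [dist_comm, dist_eq_one_iff_adj.mpr hw'] at h
        exact hne (hconn.dist_eq_zero_iff.mp (by omega : G.dist w' w = 0)).symm
    have hvr : r v ≠ v := fun h => hvc (h ▸ hr v)
    obtain ⟨u, hu, -⟩ := hconn.exists_adj_dist_succ hvr
    have hleaf : ∀ x, x ≠ v → G.dist x v = G.dist x u + 1 := by
      intro x hx
      obtain ⟨z, hz, hd⟩ := hconn.exists_adj_dist_succ hx
      rwa [huniq z u hz.symm hu.symm] at hd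
    have hbad : ∀ b, b ≠ v → G.Adj u b → (∀ s ∈ S.erase v, ¬ G.Resolves s v b) →
        s(u, b) ∈ c.edges := by
      intro b hbv hub hb
      by_contra he
      refine hno b hbv (hS.1.insert_erase_of_leaf hconn hleaf hub (hbr hub he) hbv ⟨s, hs⟩ ?_)
      intro t ht
      -- Each such `t` is as far from `b` as from the leaf `v`, that is, one farther than from `u`;
      -- so the branch of `b` contains no such `t`.
      have h1 := not_not.mp (hb t ht)
      rw [dist_comm (u := t), ← h1, dist_comm]
      exact hleaf t (Finset.ne_of_mem_erase ht)
    have huc : u ∈ c.support := by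
      by_contra huc
      refine hno u hu.ne fun x y hxy => ?_
      by_contra hcon
      push Not at hcon
      have hcon' : ∀ s ∈ S.erase v, ¬ G.Resolves s x y := fun s hs =>
        hcon s (Finset.mem_insert_of_mem hs)
      rcases hS.1.exists_resolves_or_of_leaf hleaf hu.ne' hxy with ⟨s, hs, h⟩ | ⟨rfl, h⟩ | ⟨rfl, h⟩
      · exact hcon s hs h
      · exact huc (c.fst_mem_support_of_mem_edges (hbad y hxy.symm h hcon'))
      · exact huc (c.fst_mem_support_of_mem_edges
          (hbad x hxy h fun s hs hne => hcon' s hs hne.symm))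
    have hru : r v = u := by
      have h1 := hgate v u huc
      rw [dist_eq_one_iff_adj.mpr hu.symm] at h1
      have h2 : G.dist v (r v) ≠ 0 := fun h => hvr (hconn.dist_eq_zero_iff.mp h).symm
      exact hconn.dist_eq_zero_iff.mp (by omega)
    -- By `hbad` such a `z` would be on the cycle, hence its own gate at depth 0.
    have hnc : ∀ z, z ≠ v → r z = u → G.dist z (r z) ≠ 0 → G.Adj u z →
        ¬ ∀ s ∈ S.erase v, ¬ G.Resolves s v z := by
      intro z hz hrz hd huz hcon
      have := hrc z (c.snd_mem_support_of_mem_edges (hbad z hz huz hcon))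
      exact hd (by rw [this, dist_self])
    have hrx' := hrx.trans hru
    have hry' := hrxy ▸ hrx'
    have hd0 : G.dist x (r x) ≠ 0 := by
      intro h
      have h1 := hconn.dist_eq_zero_iff.mp h
      have h2 := hconn.dist_eq_zero_iff.mp (hdxy ▸ h)
      exact hxy (by rw [h1, h2, hrxy])
    rcases hS.1.exists_resolves_or_of_leaf hleaf hu.ne' hxy with ⟨t, ht, h⟩ | ⟨rfl, h⟩ | ⟨rfl, h⟩
    · rcases Finset.mem_insert.mp ht with rfl | ht
      · exact h (by rw [← hrx', hdxy, hrxy])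
      · exact hres t ht h
    · exact hnc y hxy.symm hry' (hdxy ▸ hd0) h hres
    · exact hnc x hxy hrx' hd0 h fun s hs hne => hres s hs hne.symm
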